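/- Let $L\ge 1$, let $\mathcal S_1,\dots,\mathcal S_L$ be finite alphabets, let $(S_1,\dots,S_L)$ have the joint pmf $p(s_1,\dots,s_L)$, let $Z=\varphi(S_1,\dots,S_L)$ for a function $\varphi:\mathcal S_1\times\dots\times\mathcal S_L\to\mathcal Z$, and let $d:\mathcal Z\times\hat{\mathcal Z}\to[0,\infty)$ be a distortion measure. Cascade source coding: a code of block length $n\ge1$ consists of message sets $\mathcal M_0,\mathcal M_1,\dots,\mathcal M_L$ of finite sizes $M_0=1,M_1,\dots,M_L$, encoding functions $f_l:\mathcal S_l^n\times\mathcal M_{l-1}\to\mathcal M_l$, $l=1,\dots,L$, and a decoding function $g^{(n)}:\mathcal M_L\to\hat{\mathcal Z}^n$. With $(S_{1,i},\dots,S_{L,i})$, $i=1,\dots,n$, i.i.d. with pmf $p$, and $Z_i=\varphi(S_{1,i},\dots,S_{L,i})$, Terminal $l$ sends $m_l=f_l(S_l^n,m_{l-1})$ to Terminal $l+1$, and Terminal $L+1$ outputs $\hat Z^n=g^{(n)}(m_L)$. A rate tuple $(R_1,\dots,R_L)$ achieves distortion $D$ if for some $n\ge 1$ there is a code of block length $n$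 with $R_l\ge\frac1n\log_2 M_l$ for all $l$ and $D\ge \mathrm E\big[\frac1n\sum_{i=1}^n d(Z_i,\hat Z_i)\big]$. The rate-distortion region $\mathcal R(D)$ is the set of the rate tuples $(R_1,\dots,R_L)$ for which $(R_1,\dots,R_L,D)$ lies in the closure of the set of all $(R'_1,\dots,R'_L,D')$ such that $(R'_1,\dots,R'_L)$ achieves distortion $D'$. Let $\mathcal R_{\mathrm{IP}}(D)$ be the union of the sets of rate tuples $(R_1,\dots,R_L)$ satisfying $$R_l\ \ge\ I(S_l,U_{l-1};U_l\mid S_{l+1}),\qquad l=1,\dots,L,$$ (mutual information in bits, $U_0=S_{L+1}=\emptyset$), over all finite-alphabet $U_1,\dots,U_L$ with joint pmf $p(s_1,\dots,s_L)\prod_{l=1}^L p(u_l|s_l,u_{l-1})$ and all functions $g$ such that $\hat Z=g(U_L)$ satisfies $\mathrm E[d(Z,\hat Z)]\le D$. Then $\mathcal R_{\mathrm{IP}}(D)\subseteq\mathcal R(D)$ for every real $D$. If moreover $D>\mathrm E\big[\inf_{\hat z\in\hat{\mathcal Z}}d(Z,\hat z)\big]$, then every tuple in $\mathcal R_{\mathrm{IP}}(D)$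 lies even in the closure of the set of the rate tuples that achieve distortion $D$. -/

import Mathlib

noncomputable section

namespace Cascade

/-! ### Information measures on a finite probability space (in bits) -/

open Classical in
/-- The pmf of the random variable `X` when the underlying finite space `Ω` carries the pmf `q`. -/
def law {Ω α : Type*} [Fintype Ω] (q : Ω → ℝ) (X : Ω → α) (x : α) : ℝ :=
  ∑ ω, if X ω = x then q ω else 0

/-- The conditional mutual information `I(X;Y|T)` in bits,
`∑_{x,y,t} p(x,y,t) log₂ (p(t) p(x,y,t) / (p(x,t) p(y,t)))`.
Triples with `p(x,y,t) = 0` contribute `0`. -/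
def condMutualInfo {Ω α β γ : Type*} [Fintype Ω] [Fintype α] [Fintype β] [Fintype γ]
    (q : Ω → ℝ) (X : Ω → α) (Y : Ω → β) (T : Ω → γ) : ℝ :=
  ∑ x, ∑ y, ∑ t, law q (fun ω => (X ω, Y ω, T ω)) (x, y, t) *
    Real.logb 2 (law q T t * law q (fun ω => (X ω, Y ω, T ω)) (x, y, t) /
      (law q (fun ω => (X ω, T ω)) (x, t) * law q (fun ω => (Y ω, T ω)) (y, t)))

/-! ### Codes for the cascade

Terminal `l` of the informal numbering `1, …, L` is the index `l - 1 : Fin L`. Quantities attached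
to the links (messages, auxiliary variables) are indexed by `Fin (L + 1)`: position `0` is the
(trivial) input of the first terminal, and `l.castSucc`, `l.succ` are the input and the output of
the terminal `l : Fin L`. -/

/-- A code of block length `n` for the cascade: the message sets, the encoding functions
`f_l : S_l^n × M_{l-1} → M_l` and the decoding function `g : M_L → Zh^n`. The first terminal
receives no message, i.e. `M_0` has one element. -/
structure Code {L : ℕ} (S : Fin L → Type*) (Zh : Type*) (n : ℕ) where
  /-- The sizes of the message sets. -/
  M : Fin (L + 1) → ℕ
  M_zero : M 0 = 1
  /-- The encoding functions. -/
  enc : (l : Fin L) → (Fin n → S l) → Fin (M l.castSucc) → Fin (M l.succ)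
  /-- The decoding function. -/
  dec : Fin (M (Fin.last L)) → Fin n → Zh

/-- The messages sent along the cascade when the source block is `s` (`s i` is the `i`-th sample
of the source vector): `m_l = f_l (s_l^n, m_{l-1})`. -/
def Code.msg {L : ℕ} {S : Fin L → Type*} {Zh : Type*} {n : ℕ} (c : Code S Zh n)
    (s : Fin n → ∀ l, S l) (l : Fin (L + 1)) : Fin (c.M l) :=
  Fin.induction (motive := fun l => Fin (c.M l)) (Fin.cast c.M_zero.symm 0)
    (fun l m => c.enc l (fun i => s i l) m) l

/-- The reconstruction block `Ẑ^n = g (m_L)`. -/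
def Code.reconstruction {L : ℕ} {S : Fin L → Type*} {Zh : Type*} {n : ℕ} (c : Code S Zh n)
    (s : Fin n → ∀ l, S l) : Fin n → Zh :=
  c.dec (c.msg s (Fin.last L))

/-- The expected distortion `E[d(Z^n; Ẑ^n)]`, with `d(z^n; ẑ^n) = (1/n) ∑ i, d(z_i, ẑ_i)` and
`Z_i = φ(S_{1,i}, …, S_{L,i})`, when the source vectors are i.i.d. with pmf `p`. -/
def Code.distortion {L : ℕ} {S : Fin L → Type*} [∀ l, Fintype (S l)] {Z Zh : Type*} {n : ℕ}
    (c : Code S Zh n) (p : (∀ l, S l) → ℝ) (φ : (∀ l, S l) → Z) (d : Z → Zh → ℝ) : ℝ :=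
  ∑ s : Fin n → ∀ l, S l, (∏ i, p (s i)) *
    ((1 / (n : ℝ)) * ∑ i, d (φ (s i)) (c.reconstruction s i))

/-- The rate tuple `R` achieves distortion `D`: for some block length `n ≥ 1` there is a code with
`R_l ≥ (1/n) log₂ M_l` for all `l` and `D ≥ E[d(Z^n; Ẑ^n)]`. -/
def Achieves {L : ℕ} {S : Fin L → Type*} [∀ l, Fintype (S l)] {Z Zh : Type*}
    (p : (∀ l, S l) → ℝ) (φ : (∀ l, S l) → Z) (d : Z → Zh → ℝ) (R : Fin L → ℝ) (D : ℝ) : Prop :=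
  ∃ n : ℕ, 1 ≤ n ∧ ∃ c : Code S Zh n,
    (∀ l : Fin L, Real.logb 2 (c.M l.succ) / n ≤ R l) ∧ c.distortion p φ d ≤ D

/-- The rate-distortion region at `D`: the rate tuples `R` such that `(R, D)` lies in the closure
of the set of the pairs (rate tuple, distortion) that are achieved by codes. -/
def rdRegion {L : ℕ} {S : Fin L → Type*} [∀ l, Fintype (S l)] {Z Zh : Type*}
    (p : (∀ l, S l) → ℝ) (φ : (∀ l, S l) → Z) (d : Z → Zh → ℝ) (D : ℝ) : Set (Fin L → ℝ) :=
  {R | (R, D) ∈ closure {x : (Fin L → ℝ) × ℝ | Achieves p φ d x.1 x.2}}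

/-- The rate-distortion region for the distortion constraint `D` met exactly: the closure, in the
rates only, of the set of the rate tuples that achieve `D`. -/
def exactRDRegion {L : ℕ} {S : Fin L → Type*} [∀ l, Fintype (S l)] {Z Zh : Type*}
    (p : (∀ l, S l) → ℝ) (φ : (∀ l, S l) → Z) (d : Z → Zh → ℝ) (D : ℝ) : Set (Fin L → ℝ) :=
  closure {R | Achieves p φ d R D}

/-- The least distortion `E[inf_ẑ d(Z, ẑ)]` that is possible when the decoder knows the sources. -/
def minDistortion {L : ℕ} {S : Fin L → Type*} [∀ l, Fintype (S l)] {Z Zh : Type*}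
    (p : (∀ l, S l) → ℝ) (φ : (∀ l, S l) → Z) (d : Z → Zh → ℝ) : ℝ :=
  ∑ s, p s * ⨅ z : Zh, d (φ s) z

/-! ### The single-letter region of in-network processing -/

/-- The joint pmf `p(s_1,…,s_L) ∏_l p(u_l | s_l, u_{l-1})`. -/
def jointPmf {L : ℕ} {S : Fin L → Type*} {U : Fin (L + 1) → Type*}
    (p : (∀ l, S l) → ℝ) (W : (l : Fin L) → S l → U l.castSucc → U l.succ → ℝ)
    (ω : (∀ l, S l) × (∀ l, U l)) : ℝ :=
  p ω.1 * ∏ l : Fin L, W l (ω.1 l) (ω.2 l.castSucc) (ω.2 l.succ)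

/-- The source `S_{l+1}` of the terminal after `l`, as the subtuple of the sources with index
`l + 1`; for the last terminal this is the empty tuple, `S_{L+1} = ∅`. -/
def nextSource {L : ℕ} {S : Fin L → Type*} (l : Fin L) (s : ∀ l, S l) :
    (i : {i : Fin L // (i : ℕ) = (l : ℕ) + 1}) → S i.1 :=
  fun i => s i.1

/-- The region of in-network processing at distortion `D`: the rate tuples with
`R_l ≥ I(S_l, U_{l-1}; U_l | S_{l+1})` for all `l`, for some finite auxiliary alphabets
`U_l = Fin (k l)` (`U_0` is trivial), some conditional pmfs `W_l = p(u_l | s_l, u_{l-1})`, and some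
function `g` with `E[d(Z, g(U_L))] ≤ D`. -/
def ipRegion {L : ℕ} {S : Fin L → Type*} [∀ l, Fintype (S l)] {Z Zh : Type*}
    (p : (∀ l, S l) → ℝ) (φ : (∀ l, S l) → Z) (d : Z → Zh → ℝ) (D : ℝ) : Set (Fin L → ℝ) :=
  {R | ∃ k : Fin (L + 1) → ℕ, k 0 = 1 ∧
    ∃ W : (l : Fin L) → S l → Fin (k l.castSucc) → Fin (k l.succ) → ℝ,
      (∀ l s u, W l s u ∈ stdSimplex ℝ (Fin (k l.succ))) ∧
      ∃ g : Fin (k (Fin.last L)) → Zh,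
        ∑ ω : (∀ l, S l) × (∀ l, Fin (k l)),
            jointPmf (U := fun l => Fin (k l)) p W ω * d (φ ω.1) (g (ω.2 (Fin.last L))) ≤ D ∧
        ∀ l : Fin L,
          condMutualInfo (jointPmf (U := fun l => Fin (k l)) p W)
            (fun ω => (ω.1 l, ω.2 l.castSucc)) (fun ω => ω.2 l.succ)
            (fun ω => nextSource l ω.1) ≤ R l}

end Cascade

end

/-!
The proof is a one-shot random coding argument; no typical sequences are used.

The two ends of a link share independent uniform random variables `ω a ∈ [0, 1]`, one for each pair
`a = (u, m)` of a reproduction and a message. A party with a pmf `w` on these pairs selects the pair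
that maximizes `ω a ^ (1 / w a)`, which selects `a` with probability `w a`. Two parties with the
weights `w` and `v` that use the same `ω` both select `a` with probability at least
`w a * v a / (w a + v a)` (`le_volume_winner_eq`). The encoder, who observes `x`, uses
`W(u|x) / M` and sends the second component `m` of its choice; the decoder, who observes `y` and
`m`, uses `V(u|y)` on the pairs with this `m`. Hence the decoder outputs `u` with probability at
least `W(u|x) (1 - e)`, where `e = W(u|x) / (M V(u|y) + W(u|x))` (`exists_randomCode`).

Along the cascade these codes are drawn independently. Given the sources, the sequence `u` of all
reproductions then has a probability at least `(∏ W_l) (1 - ∑ e_l)`, and since both this law and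
`∏ W_l` have total mass one, a cost bounded by `B` exceeds its ideal mean by at most
`B * E[∑ e_l]`. Some realization of the codes does as well as the average
(`exists_oneShot_cascade`, and `exists_code_distortion_le` for blocks).

For blocks of length `n`, `M ≥ 2 ^ (n r)` and `ρ ∈ (0, 1]`, the bound `e ≤ (W / (M V)) ^ ρ` gives
`E[e] ≤ E[(2 ^ (-r) W(U|X) / V(U|Y)) ^ ρ] ^ n` (`sum_block_error_le`). For `V = p(u|y)` the mean of
`log (W(U|X) / V(U|Y))` is `I(X;U|Y)`, by the Markov chain `U - X - Y`
(`condMutualInfo_eq_of_kernel`, `law_jointPmf`); so for `r > I(X;U|Y)` the moment on the right is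
less than one for small `ρ` (`exists_rpow_mean_lt_one`), and the error decays exponentially.

The distortion constraint is met exactly, when it is above the least possible distortion, by using
on a small fraction of the block a code that forwards all sources (`exists_lossless_code`,
`exists_append_code`).
-/

noncomputable section

namespace Cascade

open MeasureTheory Finset Filter Topology
open scoped unitInterval

/-! ### A race between uniform random variables -/

theorem lintegral_unitInterval_rpow (r : ℝ) (hr : 0 ≤ r) :
    ∫⁻ x : I, ENNReal.ofReal ((x : ℝ) ^ r) = ENNReal.ofReal (1 / (1 + r)) := by
  have hm : Measurable fun x : ℝ => ENNReal.ofReal (x ^ r) := by fun_prop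
  rw [unitInterval.measurePreserving_coe.lintegral_comp hm,
    ← ofReal_integral_eq_lintegral_ofReal]
  · rw [integral_Icc_eq_integral_Ioc, ← intervalIntegral.integral_of_le zero_le_one,
      integral_rpow (Or.inl (by linarith))]
    rw [Real.one_rpow, Real.zero_rpow (by linarith), sub_zero, add_comm]
  · exact (Continuous.integrableOn_Icc (by fun_prop (disch := simp [hr])))
  · filter_upwards [ae_restrict_mem measurableSet_Icc] with x hx
    exact Real.rpow_nonneg hx.1 _

/-- For independent uniform variables, all competitors `b` stay below `ω a ^ c b` with probability
`∫ t ^ (∑ c b) = 1 / (1 + ∑ c b)`. -/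
theorem volume_race {A : Type*} [Fintype A] [DecidableEq A] (a : A) (c : A → ℝ)
    (hc : ∀ b, 0 ≤ c b) :
    volume {ω : A → I | ∀ b, b ≠ a → (ω b : ℝ) < (ω a : ℝ) ^ c b} =
      ENNReal.ofReal (1 / (1 + ∑ b : {b // b ≠ a}, c b)) := by
  set T : Set (({b : A // b = a} → I) × ({b : A // ¬ b = a} → I)) :=
    {z | ∀ b, (z.2 b : ℝ) < (z.1 ⟨a, rfl⟩ : ℝ) ^ c b} with hT
  have hTm : MeasurableSet T := by
    rw [hT, Set.ofPred_forall]
    exact MeasurableSet.iInter fun b => measurableSet_lt (by fun_prop) (by fun_prop)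
  have hS : {ω : A → I | ∀ b, b ≠ a → (ω b : ℝ) < (ω a : ℝ) ^ c b} =
      (MeasurableEquiv.piEquivPiSubtypeProd (fun _ : A => I) (· = a)) ⁻¹' T := by
    ext ω
    simp [hT, MeasurableEquiv.piEquivPiSubtypeProd, Equiv.piEquivPiSubtypeProd]
  rw [hS, (volume_preserving_piEquivPiSubtypeProd (fun _ : A => I) (· = a)).measure_preimage
    hTm.nullMeasurableSet, Measure.volume_eq_prod, Measure.prod_apply hTm]
  have hfib : ∀ t : {b : A // b = a} → I, volume (Prod.mk t ⁻¹' T) =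
      ENNReal.ofReal ((t ⟨a, rfl⟩ : ℝ) ^ (∑ b : {b // b ≠ a}, c b)) := by
    intro t
    have ht := (t ⟨a, rfl⟩).2
    have : Prod.mk t ⁻¹' T = Set.univ.pi fun b : {b : A // ¬ b = a} =>
        Set.Iio (⟨(t ⟨a, rfl⟩ : ℝ) ^ c b, Real.rpow_nonneg ht.1 _,
          Real.rpow_le_one ht.1 ht.2 (hc _)⟩ : I) := by
      ext z
      simp [hT, ← Subtype.coe_lt_coe]
    rw [this, volume_pi_pi]
    simp only [unitInterval.volume_Iio]
    rw [← ENNReal.ofReal_prod_of_nonneg fun b _ => Real.rpow_nonneg ht.1 _]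
    congr 1
    rw [Real.rpow_sum_of_nonneg ht.1 fun b _ => hc _]
  simp only [hfib]
  have := (volume_preserving_funUnique {b : A // b = a} I).lintegral_comp
    (f := fun x : I => ENNReal.ofReal ((x : ℝ) ^ (∑ b : {b // b ≠ a}, c b))) (by fun_prop)
  rw [← lintegral_unitInterval_rpow _ (sum_nonneg fun b _ => hc _), ← this]
  congr!

/-! ### Selection with shared randomness -/

/-- The event that `a` wins the race with weights `w`: among all `b`, the value `ω b ^ (1 / w b)`
is the largest for `b = a`. It is written without dividing by the weight of a competitor. -/
def Wins {A : Type*} (w : A → ℝ) (ω : A → I) (a : A) : Prop :=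
  0 < w a ∧ ∀ b, b ≠ a → (ω b : ℝ) < (ω a : ℝ) ^ (w b / w a)

theorem Wins.unique {A : Type*} {w : A → ℝ} {ω : A → I} {a b : A} (ha : Wins w ω a)
    (hb : Wins w ω b) : a = b := by
  by_contra hab
  have h1 := ha.2 b (Ne.symm hab)
  have h2 := hb.2 a hab
  have hr : 0 < w b / w a := div_pos hb.1 ha.1
  have h3 := Real.rpow_lt_rpow (ω a).2.1 h2 hr
  rw [← Real.rpow_mul (ω b).2.1, div_mul_div_cancel₀ hb.1.ne', div_self ha.1.ne',
    Real.rpow_one] at h3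
  exact lt_asymm h1 h3

theorem measurableSet_wins {A : Type*} [Fintype A] (w : A → ℝ) (a : A) :
    MeasurableSet {ω : A → I | Wins w ω a} := by
  classical
  by_cases ha : 0 < w a
  · simp only [Wins, ha, true_and, Set.ofPred_forall]
    refine MeasurableSet.iInter fun b => MeasurableSet.iInter fun _ =>
      measurableSet_lt (by fun_prop) (by fun_prop)
  · simp [Wins, ha]

open Classical in
/-- The winner of the race with weights `w`; an arbitrary element if there is none, which has
probability zero as soon as `w` is nonnegative and nonzero. -/
def winner {A : Type*} [Nonempty A] (w : A → ℝ) (ω : A → I) : A :=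
  if h : ∃ a, Wins w ω a then h.choose else Classical.arbitrary A

theorem Wins.winner_eq {A : Type*} [Nonempty A] {w : A → ℝ} {ω : A → I} {a : A}
    (h : Wins w ω a) : winner w ω = a := by
  have h' : ∃ a, Wins w ω a := ⟨a, h⟩
  rw [winner, dif_pos h']
  exact h'.choose_spec.unique h

theorem measurable_winner {A : Type*} [Fintype A] [Nonempty A] (w : A → ℝ) :
    @Measurable _ _ _ ⊤ (winner w) := by
  classical
  let : MeasurableSpace A := ⊤
  refine measurable_to_countable' fun a => ?_
  have : winner w ⁻¹' {a} = {ω | Wins w ω a} ∪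
      ((⋃ b, {ω | Wins w ω b})ᶜ ∩ {_ω | Classical.arbitrary A = a}) := by
    ext ω
    simp only [Set.mem_preimage, Set.mem_singleton_iff, Set.mem_union, Set.mem_ofPred_eq,
      Set.mem_inter_iff, Set.mem_compl_iff, Set.mem_iUnion]
    constructor
    · intro h
      by_cases h' : ∃ a, Wins w ω a
      · obtain ⟨b, hb⟩ := h'
        rw [hb.winner_eq] at h
        exact Or.inl (h ▸ hb)
      · rw [winner, dif_neg h'] at h
        exact Or.inr ⟨h', h⟩
    · rintro (h | ⟨h', h⟩)
      · exact h.winner_eq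
      · rw [winner, dif_neg h', h]
  rw [this]
  exact (measurableSet_wins w a).union
    ((MeasurableSet.iUnion fun b => measurableSet_wins w b).compl.inter (MeasurableSet.const _))

/-- Two parties that run the race on the same `ω` with different weights `w` and `v` agree on `a`
with a probability that is bounded below in terms of `w a` and `v a`: both win at `a` when `a` wins
the race with the weights `w b / w a + v b / v a` of the competitors `b`. -/
theorem le_volume_winner_eq {A : Type*} [Fintype A] [Nonempty A] (w v : A → ℝ)
    (hw : ∀ b, 0 ≤ w b) (hv : ∀ b, 0 ≤ v b) (a : A) (hwa : 0 < w a) (hva : 0 < v a) :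
    w a * v a / (v a * ∑ b, w b + w a * ∑ b, v b) ≤
      (volume : Measure (A → I)).real {ω | winner w ω = a ∧ winner v ω = a} := by
  classical
  set c : A → ℝ := fun b => w b / w a + v b / v a with hc
  have hc0 : ∀ b, 0 ≤ c b := fun b =>
    add_nonneg (div_nonneg (hw b) hwa.le) (div_nonneg (hv b) hva.le)
  have hsub : {ω : A → I | ∀ b, b ≠ a → (ω b : ℝ) < (ω a : ℝ) ^ c b} ⊆
      {ω | winner w ω = a ∧ winner v ω = a} := by
    intro ω hω
    have key : ∀ u : A → ℝ, (∀ b, 0 ≤ u b) → 0 < u a → (∀ b, u b / u a ≤ c b) →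
        winner u ω = a := by
      intro u hu hua huc
      refine Wins.winner_eq ⟨hua, fun b hb => (hω b hb).trans_le ?_⟩
      refine Real.rpow_le_rpow_of_exponent_ge' (ω a).2.1 (ω a).2.2
        (div_nonneg (hu b) hua.le) (huc b)
    exact ⟨key w hw hwa fun b => le_add_of_nonneg_right (div_nonneg (hv b) hva.le),
      key v hv hva fun b => le_add_of_nonneg_left (div_nonneg (hw b) hwa.le)⟩
  refine le_trans ?_ (measureReal_mono hsub)
  rw [measureReal_def, volume_race a c hc0, ENNReal.toReal_ofReal
    (by have := sum_nonneg fun (b : {b // b ≠ a}) (_ : b ∈ univ) => hc0 b; positivity)]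
  have hsum : 1 + ∑ b : {b // b ≠ a}, c b ≤ ∑ b, c b := by
    have h1 := Fintype.sum_eq_add_sum_subtype_ne c a
    have h2 : c a = 2 := by simp [hc, hwa.ne', hva.ne']; norm_num
    linarith
  have htot : ∑ b, c b = (v a * ∑ b, w b + w a * ∑ b, v b) / (w a * v a) := by
    simp only [hc, sum_add_distrib, ← sum_div]
    field_simp
  have hpos : 0 < 1 + ∑ b : {b // b ≠ a}, c b := by
    have := sum_nonneg fun (b : {b // b ≠ a}) (_ : b ∈ univ) => hc0 b
    linarith
  calc w a * v a / (v a * ∑ b, w b + w a * ∑ b, v b) = 1 / ∑ b, c b := by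
        rw [htot, one_div_div]
    _ ≤ _ := one_div_le_one_div_of_le hpos hsum

/-- One-shot coding with side information. The encoder observes `x` and sends `m`, and the decoder
observes `y` and produces `u`; the pair is drawn at random with pmf `π`. For all `x` and `y` the
reproduction is `u` with a probability not much less than the target `W x u`, unless
`W x u` exceeds `|M| * V y u`.

Both parties run a race on the pairs `(u, m)`: the encoder with the weight `W x u` and the decoder,
who knows `m`, with the weight `V y u` on the pairs with this second coordinate. -/
theorem exists_randomCode {X Y U M : Type*} [Fintype X] [Fintype Y] [Fintype U] [Fintype M]
    [DecidableEq X] [DecidableEq Y] [DecidableEq U] [DecidableEq M]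
    [Nonempty U] [Nonempty M] (W : X → U → ℝ) (V : Y → U → ℝ)
    (hW : ∀ x u, 0 ≤ W x u) (hW1 : ∀ x, ∑ u, W x u ≤ 1)
    (hV : ∀ y u, 0 ≤ V y u) (hV1 : ∀ y, ∑ u, V y u ≤ 1) :
    ∃ π : (X → M) × (Y → M → U) → ℝ, (∀ f, 0 ≤ π f) ∧ ∑ f, π f = 1 ∧ ∀ x y u,
      W x u * (Fintype.card M * V y u / (Fintype.card M * V y u + W x u)) ≤
        ∑ f, if f.2 y (f.1 x) = u then π f else 0 := by
  let F := (X → M) × (Y → M → U)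
  let w : X → U × M → ℝ := fun x a => W x a.1
  let v : Y → M → U × M → ℝ := fun y m a => if a.2 = m then V y a.1 else 0
  let code : (U × M → I) → F := fun ω =>
    (fun x => (winner (w x) ω).2, fun y m => (winner (v y m) ω).1)
  let : MeasurableSpace M := ⊤
  let : MeasurableSpace U := ⊤
  have hcode : Measurable code := by
    have hwin : ∀ w : U × M → ℝ, Measurable (winner w) :=
      fun w => (measurable_winner w).mono le_rfl le_top
    refine Measurable.prodMk (measurable_pi_lambda _ fun x => ?_)
      (measurable_pi_lambda _ fun y => measurable_pi_lambda _ fun m => ?_)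
    · exact measurable_snd.comp (hwin _)
    · exact measurable_fst.comp (hwin _)
  have hfib : ∀ f : F, MeasurableSet (code ⁻¹' {f}) := fun f => hcode (measurableSet_singleton f)
  let μ : Measure (U × M → I) := volume
  have hsum : ∀ s : Finset F, ∑ f ∈ s, μ.real (code ⁻¹' {f}) = μ.real (code ⁻¹' s) :=
    fun s => sum_measureReal_preimage_singleton s fun f _ => hfib f
  refine ⟨fun f => μ.real (code ⁻¹' {f}), fun f => measureReal_nonneg, ?_, fun x y u => ?_⟩
  · rw [hsum]
    simp [μ]
  · rw [← sum_filter, hsum]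
    have hM : (0 : ℝ) < Fintype.card M := by exact_mod_cast Fintype.card_pos
    rcases (hW x u).eq_or_lt with hWu | hWu
    · simp [← hWu, measureReal_nonneg]
    rcases (hV y u).eq_or_lt with hVu | hVu
    · simp [← hVu, measureReal_nonneg]
    have hwsum : ∑ a, w x a ≤ Fintype.card M := by
      rw [Fintype.sum_prod_type_right]
      calc ∑ _m : M, ∑ u, W x u ≤ ∑ _m : M, 1 := sum_le_sum fun _ _ => hW1 x
        _ = Fintype.card M := by simp
    have hvsum : ∀ m, ∑ a, v y m a ≤ 1 := by
      intro m
      rw [Fintype.sum_prod_type]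
      simpa [v] using hV1 y
    -- the probability that the message is `m` and both parties select `(u, m)`
    have hterm : ∀ m, W x u * V y u / (V y u * Fintype.card M + W x u) ≤
        μ.real (code ⁻¹' {f | f.1 x = m ∧ f.2 y m = u}) := by
      intro m
      have hv : ∀ b, 0 ≤ v y m b := fun b => by
        simp only [v]; split_ifs; exacts [hV _ _, le_rfl]
      have h1 := le_volume_winner_eq (w x) (v y m) (fun b => hW _ _) hv (u, m) hWu
        (by simpa [v] using hVu)
      refine le_trans ?_ (h1.trans (measureReal_mono ?_))
      · have hvm : v y m (u, m) = V y u := by simp [v]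
        have hwm : w x (u, m) = W x u := rfl
        rw [hvm, hwm]
        have hws : 0 < ∑ a, w x a :=
          sum_pos' (fun a _ => hW _ _) ⟨(u, m), mem_univ _, hWu⟩
        have hvs : 0 ≤ ∑ a, v y m a := sum_nonneg fun a _ => hv a
        refine div_le_div_of_nonneg_left (by positivity) (by positivity) ?_
        refine add_le_add (mul_le_mul_of_nonneg_left hwsum hVu.le) ?_
        simpa using mul_le_mul_of_nonneg_left (hvsum m) hWu.le
      · rintro ω ⟨h2, h3⟩
        simp only [code, Set.mem_preimage, Set.mem_ofPred_eq, h2, h3, and_self]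
    calc W x u * (Fintype.card M * V y u / (Fintype.card M * V y u + W x u))
        = ∑ _m : M, W x u * V y u / (V y u * Fintype.card M + W x u) := by
          simp only [sum_const, card_univ, nsmul_eq_mul]
          rw [mul_comm (V y u)]
          ring
      _ ≤ ∑ m : M, μ.real (code ⁻¹' {f | f.1 x = m ∧ f.2 y m = u}) :=
          sum_le_sum fun m _ => hterm m
      _ = μ.real (⋃ m ∈ (univ : Finset M), code ⁻¹' {f | f.1 x = m ∧ f.2 y m = u}) := by
          refine (measureReal_biUnion_finset ?_ fun m _ => hcode (Set.toFinite _).measurableSet).symm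
          intro m _ m' _ hmm
          refine Set.disjoint_left.2 fun ω h h' => hmm ?_
          exact h.1.symm.trans h'.1
      _ ≤ _ := by
          refine measureReal_mono ?_
          intro ω hω
          simp only [mem_univ, Set.iUnion_true, Set.mem_iUnion] at hω
          obtain ⟨m, h1, h2⟩ := hω
          simp only [coe_filter, mem_univ, true_and, Set.mem_preimage, Set.mem_ofPred_eq]
          rw [h1, h2]

/-! ### The Markov chain of the auxiliary variables -/

/-- Summing out the last state of a chain with the kernels `K l`. -/
theorem sum_chain_snoc {L : ℕ} {U : Fin (L + 2) → Type*} [∀ i, Fintype (U i)]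
    (K : (l : Fin (L + 1)) → U l.castSucc → U l.succ → ℝ) (F : (∀ i, U i) → ℝ) :
    ∑ u, F u * ∏ l, K l (u l.castSucc) (u l.succ) =
      ∑ u' : ∀ i : Fin (L + 1), U i.castSucc,
        (∑ w : U (Fin.last L).succ, F (Fin.snoc u' w) * K (Fin.last L) (u' (Fin.last L)) w) *
          ∏ l : Fin L, K l.castSucc (u' l.castSucc) (u' l.succ) := by
  rw [← (Fin.snocEquiv U).sum_comp, Fintype.sum_prod_type_right]
  refine sum_congr rfl fun u' _ => ?_
  rw [sum_mul]
  refine sum_congr rfl fun w _ => ?_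
  rw [Fin.prod_univ_castSucc]
  have h1 : ∀ i : Fin (L + 1), (Fin.snocEquiv U) (w, u') i.castSucc = u' i := fun i => by
    simp [Fin.snocEquiv]
  have h2 : (Fin.snocEquiv U) (w, u') (Fin.last (L + 1)) = w := by
    simp [Fin.snocEquiv]
  have h3 : (Fin.snocEquiv U) (w, u') (Fin.last L).succ = w := h2
  have h4 : ∀ i : Fin L, (Fin.snocEquiv U) (w, u') i.castSucc.succ = u' i.succ := fun i => h1 i.succ
  simp only [h1, h3, h4]
  rw [mul_comm (∏ _, _), ← mul_assoc]
  rfl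

theorem sum_chain_eq_card {L : ℕ} {U : Fin (L + 1) → Type*} [∀ i, Fintype (U i)]
    (K : (l : Fin L) → U l.castSucc → U l.succ → ℝ) (hK : ∀ l u, ∑ w, K l u w = 1) :
    ∑ u : ∀ i, U i, ∏ l, K l (u l.castSucc) (u l.succ) = Fintype.card (U 0) := by
  induction L with
  | zero =>
    simp [Fintype.card_pi]
  | succ L ih =>
    have h := sum_chain_snoc K fun _ => 1
    simp only [one_mul, hK] at h
    rw [h]
    exact ih (U := fun i => U i.castSucc) (fun l => K l.castSucc) fun l u => hK _ u

/-- Given its predecessor, the `(l + 1)`-st state of the chain has the law `K l`, whatever the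
later kernels are. -/
theorem sum_chain_markov {L : ℕ} {U : Fin (L + 1) → Type*} [∀ i, Fintype (U i)]
    (K : (l : Fin L) → U l.castSucc → U l.succ → ℝ) (hK : ∀ l u, ∑ w, K l u w = 1)
    (l : Fin L) (G : U l.castSucc → U l.succ → ℝ) :
    ∑ u : ∀ i, U i, G (u l.castSucc) (u l.succ) * ∏ j, K j (u j.castSucc) (u j.succ) =
      ∑ u : ∀ i, U i, (∑ w, G (u l.castSucc) w * K l (u l.castSucc) w) *
        ∏ j, K j (u j.castSucc) (u j.succ) := by
  induction L with
  | zero => exact l.elim0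
  | succ L ih =>
    have h1 : ∀ (u' : ∀ i : Fin (L + 1), U i.castSucc) w (i : Fin (L + 1)),
        (Fin.snoc u' w : ∀ i, U i) i.castSucc = u' i := fun u' w i => by simp
    have h2 : ∀ (u' : ∀ i : Fin (L + 1), U i.castSucc) w,
        (Fin.snoc u' w : ∀ i, U i) (Fin.last L).succ = w := fun u' w => Fin.snoc_last _ _
    have h3 : ∀ (u' : ∀ i : Fin (L + 1), U i.castSucc) w (i : Fin L),
        (Fin.snoc u' w : ∀ i, U i) i.castSucc.succ = u' i.succ := fun u' w i => h1 u' w i.succ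
    rw [sum_chain_snoc K fun u => G (u l.castSucc) (u l.succ),
      sum_chain_snoc K fun u => ∑ w, G (u l.castSucc) w * K l (u l.castSucc) w]
    induction l using Fin.lastCases with
    | last =>
      simp only [h1, h2, ← mul_sum, hK, mul_one]
    | cast l =>
      simp only [h1, h3, ← mul_sum, hK, mul_one]
      exact ih (U := fun i => U i.castSucc) (fun l => K l.castSucc) (fun l u => hK _ u) l G

theorem law_nonneg {Ω α : Type*} [Fintype Ω] {q : Ω → ℝ} (hq : ∀ ω, 0 ≤ q ω) (X : Ω → α) (x : α) :
    0 ≤ law q X x :=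
  sum_nonneg fun ω _ => by split_ifs; exacts [hq ω, le_rfl]

theorem le_law {Ω α : Type*} [Fintype Ω] {q : Ω → ℝ} (hq : ∀ ω, 0 ≤ q ω) (X : Ω → α) (ω : Ω) :
    q ω ≤ law q X (X ω) := by
  classical
  have := single_le_sum (f := fun ω' => if X ω' = X ω then q ω' else 0)
    (fun ω' _ => by split_ifs; exacts [hq ω', le_rfl]) (mem_univ ω)
  simpa [law] using this

/-- The expectation of a function of `X` in terms of the law of `X`. -/
theorem sum_law_mul {Ω α : Type*} [Fintype Ω] [Fintype α] (q : Ω → ℝ) (X : Ω → α) (F : α → ℝ) :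
    ∑ x, law q X x * F x = ∑ ω, q ω * F (X ω) := by
  classical
  simp only [law, sum_mul, ite_mul, zero_mul]
  rw [sum_comm]
  refine sum_congr rfl fun ω _ => ?_
  simp

theorem sum_law {Ω α : Type*} [Fintype Ω] [Fintype α] (q : Ω → ℝ) (X : Ω → α) :
    ∑ x, law q X x = ∑ ω, q ω := by
  simpa using sum_law_mul q X fun _ => 1

theorem sum_law_prod_left {Ω α β : Type*} [Fintype Ω] [Fintype α] (q : Ω → ℝ)
    (X : Ω → α) (Y : Ω → β) (y : β) :
    ∑ x, law q (fun ω => (X ω, Y ω)) (x, y) = law q Y y := by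
  classical
  simp only [law]
  rw [sum_comm]
  refine sum_congr rfl fun ω _ => ?_
  simp [Prod.ext_iff, ite_and]

theorem jointPmf_nonneg {L : ℕ} {S : Fin L → Type*} {U : Fin (L + 1) → Type*}
    {p : (∀ l, S l) → ℝ} (hp : ∀ s, 0 ≤ p s)
    {W : (l : Fin L) → S l → U l.castSucc → U l.succ → ℝ} (hW : ∀ l s u v, 0 ≤ W l s u v)
    (ω : (∀ l, S l) × (∀ l, U l)) : 0 ≤ jointPmf p W ω :=
  mul_nonneg (hp _) (prod_nonneg fun l _ => hW l _ _ _)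

section Joint

variable {L : ℕ} {S : Fin L → Type*} [∀ l, Fintype (S l)]
  {U : Fin (L + 1) → Type*} [∀ l, Fintype (U l)]

theorem sum_jointPmf (hU : Fintype.card (U 0) = 1) {p : (∀ l, S l) → ℝ} (hp : ∑ s, p s = 1)
    {W : (l : Fin L) → S l → U l.castSucc → U l.succ → ℝ} (hW : ∀ l s u, ∑ v, W l s u v = 1) :
    ∑ ω, jointPmf p W ω = 1 := by
  rw [Fintype.sum_prod_type]
  simp only [jointPmf, ← mul_sum]
  rw [← hp]
  refine sum_congr rfl fun s _ => ?_
  rw [sum_chain_eq_card (fun l => W l (s l)) fun l => hW l _, hU]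
  simp

/-- The Markov chain `U_l - (S_l, U_{l-1}) - T` for every function `T` of the sources. -/
theorem law_jointPmf {τ : Type*} (p : (∀ l, S l) → ℝ)
    {W : (l : Fin L) → S l → U l.castSucc → U l.succ → ℝ} (hW : ∀ l s u, ∑ v, W l s u v = 1)
    (l : Fin L) (T : (∀ l, S l) → τ) (x : S l × U l.castSucc) (v : U l.succ) (t : τ) :
    law (jointPmf p W) (fun ω => ((ω.1 l, ω.2 l.castSucc), ω.2 l.succ, T ω.1)) (x, v, t) =
      law (jointPmf p W) (fun ω => ((ω.1 l, ω.2 l.castSucc), T ω.1)) (x, t) * W l x.1 x.2 v := by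
  classical
  obtain ⟨a, b⟩ := x
  simp only [law, Fintype.sum_prod_type, Prod.mk.injEq, jointPmf, sum_mul]
  refine sum_congr rfl fun s _ => ?_
  by_cases hs : s l = a ∧ T s = t
  · have h := sum_chain_markov (fun l => W l (s l)) (fun l => hW l _) l
      fun b' v' => if b' = b ∧ v' = v then p s else 0
    simp only [ite_and, ite_mul, zero_mul] at h ⊢
    simp only [hs.1, hs.2, if_true]
    refine (Eq.trans ?_ (h.trans ?_)) <;> refine sum_congr rfl fun u _ => ?_
    · rfl
    · by_cases hb : u l.castSucc = b
      · subst hb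
        simp [hs.1]
        ring
      · simp [hb]
  · refine sum_congr rfl fun u _ => ?_
    have : ∀ P Q : Prop, ((s l = a ∧ P) ∧ Q ∧ T s = t) ↔ False := by tauto
    have h2 : ∀ P : Prop, ((s l = a ∧ P) ∧ T s = t) ↔ False := by tauto
    simp only [this, h2, if_false, zero_mul]

end Joint

/-! ### Codes from their message sequences -/

/-- A code may be given with arbitrary finite message sets; its reconstruction is determined by any
sequence of messages that obeys the encoding rule. -/
theorem exists_code {L : ℕ} {S : Fin L → Type*} {Zh : Type*} {n : ℕ} (Msg : Fin (L + 1) → Type*)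
    [∀ l, Fintype (Msg l)] (h0 : Fintype.card (Msg 0) = 1)
    (enc : (l : Fin L) → (Fin n → S l) → Msg l.castSucc → Msg l.succ)
    (dec : Msg (Fin.last L) → Fin n → Zh) :
    ∃ c : Code S Zh n, (∀ l, c.M l = Fintype.card (Msg l)) ∧
      ∀ (s : Fin n → ∀ l, S l) (m : ∀ l, Msg l),
        (∀ l : Fin L, m l.succ = enc l (fun i => s i l) (m l.castSucc)) →
          c.reconstruction s = dec (m (Fin.last L)) := by
  classical
  let e : ∀ l, Msg l ≃ Fin (Fintype.card (Msg l)) := fun l => Fintype.equivFin _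
  let c : Code S Zh n :=
    { M := fun l => Fintype.card (Msg l)
      M_zero := h0
      enc := fun l s m => e l.succ (enc l s ((e l.castSucc).symm m))
      dec := fun m => dec ((e _).symm m) }
  refine ⟨c, fun l => rfl, fun s m hm => ?_⟩
  have hmsg : ∀ l, c.msg s l = e l (m l) := by
    intro l
    induction l using Fin.induction with
    | zero =>
      have : Subsingleton (Fin (Fintype.card (Msg 0))) := by rw [h0]; infer_instance
      exact Subsingleton.elim (α := Fin (Fintype.card (Msg 0))) _ _
    | succ l ih =>
      have : c.msg s l.succ = c.enc l (fun i => s i l) (c.msg s l.castSucc) := rfl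
      rw [this, ih, hm]
      simp [c]
  rw [Code.reconstruction, hmsg]
  simp [c]

/-! ### Random coding for the cascade -/

theorem one_sub_sum_le_prod {ι : Type*} (s : Finset ι) (e : ι → ℝ) (h0 : ∀ i, 0 ≤ e i)
    (h1 : ∀ i, e i ≤ 1) : 1 - ∑ i ∈ s, e i ≤ ∏ i ∈ s, (1 - e i) := by
  classical
  induction s using Finset.induction_on with
  | empty => simp
  | insert a s ha ih =>
    rw [sum_insert ha, prod_insert ha]
    have h2 : ∏ i ∈ s, (1 - e i) ≤ 1 :=
      prod_le_one (fun i _ => sub_nonneg.2 (h1 i)) fun i _ => sub_le_self _ (h0 i)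
    nlinarith [h0 a, mul_le_mul_of_nonneg_left h2 (h0 a)]

/-- A mean is at least some value of the averaged function. -/
theorem exists_le_of_sum_mul_le {ι : Type*} [Fintype ι] {w F : ι → ℝ} {C : ℝ}
    (hw : ∀ i, 0 ≤ w i) (hw1 : ∑ i, w i = 1) (h : ∑ i, w i * F i ≤ C) : ∃ i, F i ≤ C := by
  by_contra! hF
  have h1 : ∑ i, w i * (F i - C) ≤ 0 := by
    simp only [mul_sub, sum_sub_distrib, ← sum_mul, hw1]
    linarith
  have h2 : ∀ i ∈ univ, 0 ≤ w i * (F i - C) := fun i _ =>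
    mul_nonneg (hw i) (sub_nonneg.2 (hF i).le)
  have h3 := (sum_eq_zero_iff_of_nonneg h2).1 (le_antisymm h1 (sum_nonneg h2))
  have h4 : ∀ i, w i = 0 := fun i =>
    (mul_eq_zero.1 (h3 i (mem_univ i))).resolve_right (sub_ne_zero.2 (hF i).ne')
  simp [h4] at hw1

/-- Comparing the mean of a bounded function under `Q` and under `R`, when `Q` is bounded below by
`R * (1 - E)`: since the total masses agree, `Q` exceeds `R` by at most the total of `R * E`. -/
theorem sum_mul_le_of_le {ι : Type*} [Fintype ι] {Q R E F : ι → ℝ} {B : ℝ}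
    (hQR : ∑ i, Q i = ∑ i, R i) (hR : ∀ i, 0 ≤ R i) (hE : ∀ i, 0 ≤ E i)
    (h : ∀ i, R i * (1 - E i) ≤ Q i) (hF : ∀ i, 0 ≤ F i) (hB : ∀ i, F i ≤ B) :
    ∑ i, Q i * F i ≤ ∑ i, R i * (F i + B * E i) := by
  have h1 : ∀ i ∈ univ, Q i * F i ≤ R i * (F i + B * E i) + B * (Q i - R i) := by
    intro i _
    have := mul_le_mul_of_nonneg_left (hB i) (sub_nonneg.2 (h i))
    have := mul_nonneg (mul_nonneg (hR i) (hE i)) (hF i)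
    nlinarith
  refine (sum_le_sum h1).trans_eq ?_
  rw [sum_add_distrib, ← mul_sum, sum_sub_distrib, hQR]
  ring

section OneShot

variable {L : ℕ} {Ω : Type*} [Fintype Ω] {X Y : Fin L → Type*}
  [∀ l, Fintype (X l)] [∀ l, Fintype (Y l)]
  {U : Fin (L + 1) → Type*} [∀ i, Fintype (U i)]

/-- One-shot coding for the cascade. Terminal `l` observes `x l s`, its successor observes `y l s`.
For suitable encoders and decoders `f l` of the links, the sequence `u` of the reproductions has a
cost at most that of the sequence drawn with the kernels `W l`, up to an error term for each link.

Drawing the codes of the links independently, each as in `exists_randomCode`, produces every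
sequence `u` with a probability at least `∏ l, W l * (1 - e l)`. -/
theorem exists_oneShot_cascade (hU : Fintype.card (U 0) = 1) (x : (l : Fin L) → Ω → X l)
    (y : (l : Fin L) → Ω → Y l) (W : (l : Fin L) → X l → U l.castSucc → U l.succ → ℝ)
    (V : (l : Fin L) → Y l → U l.succ → ℝ)
    (hW : ∀ l x u v, 0 ≤ W l x u v) (hW1 : ∀ l x u, ∑ v, W l x u v = 1)
    (hV : ∀ l y v, 0 ≤ V l y v) (hV1 : ∀ l y, ∑ v, V l y v ≤ 1)
    [∀ i, Nonempty (U i)] (N : Fin L → ℕ) (hN : ∀ l, 0 < N l)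
    (P : Ω → ℝ) (hP : ∀ s, 0 ≤ P s) (F : Ω → (∀ i, U i) → ℝ) (B : ℝ)
    (hF : ∀ s u, 0 ≤ F s u) (hB : ∀ s u, F s u ≤ B) :
    ∃ f : (l : Fin L) → (X l × U l.castSucc → Fin (N l)) × (Y l → Fin (N l) → U l.succ),
      ∃ u : Ω → ∀ i, U i,
        (∀ s l, (f l).2 (y l s) ((f l).1 (x l s, u s l.castSucc)) = u s l.succ) ∧
        ∑ s, P s * F s (u s) ≤
          ∑ s, P s * ∑ u, (∏ l, W l (x l s) (u l.castSucc) (u l.succ)) *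
            (F s u + B * ∑ l, W l (x l s) (u l.castSucc) (u l.succ) /
              (N l * V l (y l s) (u l.succ) + W l (x l s) (u l.castSucc) (u l.succ))) := by
  classical
  have hNe : ∀ l, Nonempty (Fin (N l)) := fun l => ⟨⟨0, hN l⟩⟩
  have hex := fun l => exists_randomCode (M := Fin (N l))
    (fun z : X l × U l.castSucc => W l z.1 z.2) (V l) (fun z v => hW _ _ _ _)
    (fun z => (hW1 _ _ _).le) (hV l) (hV1 l)
  choose π hπ hπ1 hπW using hex
  simp only [Fintype.card_fin] at hπW
  obtain ⟨u₀, hu₀⟩ := Fintype.card_eq_one_iff.1 hU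
  let C := (l : Fin L) → (X l × U l.castSucc → Fin (N l)) × (Y l → Fin (N l) → U l.succ)
  let next := fun (f : C) s l (v : U l.castSucc) => (f l).2 (y l s) ((f l).1 (x l s, v))
  let T := fun f s i => Fin.induction (motive := U) u₀ (fun l v => next f s l v) i
  have hT : ∀ f s u, (∀ l, next f s l (u l.castSucc) = u l.succ) ↔ u = T f s := by
    intro f s u
    constructor
    · intro h
      funext i
      induction i using Fin.induction with
      | zero => exact hu₀ _
      | succ l ih =>
        rw [← h l, ih]
        rfl
    · rintro rfl l
      rfl
  -- the law of the sequence of reproductions, given the sources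
  let Q : Ω → (∀ i, U i) → ℝ := fun s u => ∑ f : C, (∏ l, π l (f l)) * if u = T f s then 1 else 0
  have hπall : ∑ f : C, ∏ l, π l (f l) = 1 := by
    exact (Fintype.prod_sum π).symm.trans (prod_eq_one fun l _ => hπ1 l)
  have hQF : ∀ s, ∑ u, Q s u * F s u = ∑ f : C, (∏ l, π l (f l)) * F s (T f s) := by
    intro s
    simp only [Q, sum_mul]
    rw [sum_comm]
    refine sum_congr rfl fun f _ => ?_
    simp
  have hQ1 : ∀ s, ∑ u, Q s u = 1 := by
    intro s
    simp only [Q]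
    rw [sum_comm]
    refine Eq.trans ?_ hπall
    refine sum_congr rfl fun f _ => ?_
    simp
  have hQle : ∀ s u, (∏ l, W l (x l s) (u l.castSucc) (u l.succ)) *
      (1 - ∑ l, W l (x l s) (u l.castSucc) (u l.succ) /
        (N l * V l (y l s) (u l.succ) + W l (x l s) (u l.castSucc) (u l.succ))) ≤ Q s u := by
    intro s u
    have hQprod : Q s u = ∏ l, ∑ f, if f.2 (y l s) (f.1 (x l s, u l.castSucc)) = u l.succ
        then π l f else 0 := by
      have h := Fintype.prod_sum fun l
        (f : (X l × U l.castSucc → Fin (N l)) × (Y l → Fin (N l) → U l.succ)) =>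
          if f.2 (y l s) (f.1 (x l s, u l.castSucc)) = u l.succ then π l f else 0
      rw [h]
      refine sum_congr rfl fun f _ => ?_
      rw [prod_ite_zero]
      simp only [← hT, next, mem_univ, true_implies, mul_ite, mul_one, mul_zero]
    have hden : ∀ l, 0 ≤ (N l : ℝ) * V l (y l s) (u l.succ) := fun l =>
      mul_nonneg (Nat.cast_nonneg _) (hV _ _ _)
    rw [hQprod]
    refine le_trans (mul_le_mul_of_nonneg_left (one_sub_sum_le_prod univ _ (fun l => ?_)
      fun l => ?_) (prod_nonneg fun l _ => hW _ _ _ _)) ?_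
    · exact div_nonneg (hW _ _ _ _) (add_nonneg (hden l) (hW _ _ _ _))
    · exact div_le_one_of_le₀ (le_add_of_nonneg_left (hden l)) (add_nonneg (hden l) (hW _ _ _ _))
    · rw [← prod_mul_distrib]
      refine prod_le_prod (fun l _ => mul_nonneg (hW _ _ _ _) (sub_nonneg.2 ?_)) fun l _ => ?_
      · exact div_le_one_of_le₀ (le_add_of_nonneg_left (hden l)) (add_nonneg (hden l) (hW _ _ _ _))
      · refine le_trans (le_of_eq ?_) (hπW l (x l s, u l.castSucc) (y l s) (u l.succ))
        rcases (hW l (x l s) (u l.castSucc) (u l.succ)).eq_or_lt with h | h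
        · simp [← h]
        · congr 1
          have := hden l
          rw [eq_div_iff (by positivity), sub_mul, div_mul_cancel₀ _ (by positivity)]
          ring
  have hmean : ∑ f : C, (∏ l, π l (f l)) * ∑ s, P s * F s (T f s) ≤
      ∑ s, P s * ∑ u, (∏ l, W l (x l s) (u l.castSucc) (u l.succ)) *
        (F s u + B * ∑ l, W l (x l s) (u l.castSucc) (u l.succ) /
          (N l * V l (y l s) (u l.succ) + W l (x l s) (u l.castSucc) (u l.succ))) := by
    have hswap : ∑ f : C, (∏ l, π l (f l)) * ∑ s, P s * F s (T f s) =
        ∑ s, P s * ∑ u, Q s u * F s u := by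
      simp only [hQF, mul_sum]
      rw [sum_comm]
      exact sum_congr rfl fun s _ => sum_congr rfl fun f _ => mul_left_comm _ _ _
    rw [hswap]
    refine sum_le_sum fun s _ => ?_
    refine mul_le_mul_of_nonneg_left (sum_mul_le_of_le ?_ (fun u => prod_nonneg fun l _ =>
      hW _ _ _ _) (fun u => sum_nonneg fun l _ => ?_) (hQle s) (hF s) (hB s)) (hP s)
    · rw [hQ1, sum_chain_eq_card (fun l => W l (x l s)) fun l => hW1 l _, hU, Nat.cast_one]
    · exact div_nonneg (hW _ _ _ _)
        (add_nonneg (mul_nonneg (Nat.cast_nonneg _) (hV _ _ _)) (hW _ _ _ _))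
  obtain ⟨f, hf⟩ := exists_le_of_sum_mul_le (fun f : C => prod_nonneg fun l _ => hπ l (f l)) hπall hmean
  exact ⟨f, T f, fun s => (hT f s _).2 rfl, hf⟩

end OneShot

/-! ### Block codes from the one-shot scheme -/

/-- The subtuple of the sources that the terminal `l` observes, as a function of its own source:
it equals `nextSource` of the preceding terminal. -/
def ownSource {L : ℕ} {S : Fin L → Type*} (l : Fin L) (a : S l) :
    (i : {i : Fin L // (i : ℕ) = (l.castSucc : ℕ)}) → S i.1 :=
  fun i => cast (congrArg S (Fin.ext i.2 : i.1 = l)).symm a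

theorem ownSource_apply {L : ℕ} {S : Fin L → Type*} (l : Fin L) (s : ∀ l, S l) :
    ownSource l (s l) = fun i : {i : Fin L // (i : ℕ) = (l.castSucc : ℕ)} => s i.1 := by
  funext ⟨j, hj⟩
  obtain rfl : j = l := Fin.ext hj
  rfl

section Block

variable {L : ℕ} {S : Fin L → Type*} [∀ l, Fintype (S l)]
  {U : Fin (L + 1) → Type*} [∀ l, Fintype (U l)]

/-- The pairs (source block, auxiliary blocks) as blocks of pairs. -/
def blockEquiv (S : Fin L → Type*) (U : Fin (L + 1) → Type*) (n : ℕ) :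
    (Fin n → (∀ l, S l) × (∀ l, U l)) ≃ (Fin n → ∀ l, S l) × (∀ l, Fin n → U l) :=
  (Equiv.arrowProdEquivProdArrow _ _ _).trans (Equiv.prodCongr (Equiv.refl _) (Equiv.piComm _))

theorem sum_block_prod_eq_one {ι α : Type*} [Fintype ι] [DecidableEq ι] [Fintype α]
    (P : ι → α → ℝ) (h : ∀ i, ∑ a, P i a = 1) : ∑ v : ι → α, ∏ i, P i (v i) = 1 := by
  rw [← Fintype.prod_sum]
  simp [h]

/-- Random coding for the cascade with blocks of length `n`, message sets of the sizes `N l`, and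
the kernels `V l`, by which the receiver of the link `l` models the auxiliary variable given its
own source. -/
theorem exists_code_distortion_le {Z Zh : Type*} (hU : Fintype.card (U 0) = 1)
    [∀ i, Nonempty (U i)]
    (p : (∀ l, S l) → ℝ) (hp : ∀ s, 0 ≤ p s)
    (W : (l : Fin L) → S l → U l.castSucc → U l.succ → ℝ)
    (hW : ∀ l s u v, 0 ≤ W l s u v) (hW1 : ∀ l s u, ∑ v, W l s u v = 1)
    (V : (l : Fin L) → ((i : {i : Fin L // (i : ℕ) = (l : ℕ) + 1}) → S i.1) → U l.succ → ℝ)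
    (hV : ∀ l t v, 0 ≤ V l t v) (hV1 : ∀ l t, ∑ v, V l t v ≤ 1)
    (φ : (∀ l, S l) → Z) (d : Z → Zh → ℝ) (hd : ∀ z zh, 0 ≤ d z zh) (g : U (Fin.last L) → Zh)
    (B : ℝ) (hB : ∀ s u, d (φ s) (g u) ≤ B) (n : ℕ) (hn : 1 ≤ n)
    (N : Fin L → ℕ) (hN : ∀ l, 0 < N l) :
    ∃ c : Code S Zh n, (∀ l : Fin L, c.M l.succ = N l) ∧
      c.distortion p φ d ≤ ∑ ω : Fin n → (∀ l, S l) × (∀ l, U l), (∏ i, jointPmf p W (ω i)) *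
        ((1 / (n : ℝ)) * ∑ i, d (φ (ω i).1) (g ((ω i).2 (Fin.last L))) +
          B * ∑ l : Fin L, (∏ i, W l ((ω i).1 l) ((ω i).2 l.castSucc) ((ω i).2 l.succ)) /
            (N l * (∏ i, V l (nextSource l (ω i).1) ((ω i).2 l.succ)) +
              ∏ i, W l ((ω i).1 l) ((ω i).2 l.castSucc) ((ω i).2 l.succ))) := by
  classical
  have hn' : (0 : ℝ) < n := by exact_mod_cast hn
  have hV1' : ∀ (l : Fin L) (t : Fin n → (i : {i : Fin L // (i : ℕ) = (l : ℕ) + 1}) → S i.1),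
      ∑ v : Fin n → U l.succ, ∏ i, V l (t i) (v i) ≤ 1 := by
    intro l t
    rw [← Fintype.prod_sum fun i a => V l (t i) a]
    exact prod_le_one (fun i _ => sum_nonneg fun v _ => hV _ _ _) fun i _ => hV1 _ _
  obtain ⟨f, u, hu, hle⟩ := exists_oneShot_cascade (Ω := Fin n → ∀ l, S l)
    (X := fun l => Fin n → S l)
    (Y := fun l => Fin n → (i : {i : Fin L // (i : ℕ) = (l : ℕ) + 1}) → S i.1)
    (U := fun i => Fin n → U i) (by simp [hU])
    (fun l s i => s i l) (fun l s i => nextSource l (s i))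
    (fun l x v v' => ∏ i, W l (x i) (v i) (v' i)) (fun l t v => ∏ i, V l (t i) (v i))
    (fun l x v v' => prod_nonneg fun i _ => hW _ _ _ _)
    (fun l x v => sum_block_prod_eq_one (fun i => W l (x i) (v i)) fun i => hW1 _ _ _)
    (fun l t v => prod_nonneg fun i _ => hV _ _ _) hV1' N hN
    (fun s => ∏ i, p (s i)) (fun s => prod_nonneg fun i _ => hp _)
    (fun s u => (1 / (n : ℝ)) * ∑ i, d (φ (s i)) (g (u (Fin.last L) i))) B
    (fun s u => mul_nonneg (by positivity) (sum_nonneg fun i _ => hd _ _))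
    (fun s u => by
      have : ∑ i, d (φ (s i)) (g (u (Fin.last L) i)) ≤ n * B := by
        simpa using sum_le_card_nsmul univ _ B fun i _ => hB (s i) (u (Fin.last L) i)
      rwa [one_div_mul_eq_div, div_le_iff₀' hn'])
  -- the decoders by position: the receiver at position `i` observes the source with index `i`
  let Nm : Fin (L + 1) → ℕ := Fin.cons 1 N
  let decoder : (i : Fin (L + 1)) → (Fin n → (j : {j : Fin L // (j : ℕ) = i}) → S j.1) →
      Fin (Nm i) → (Fin n → U i) :=
    fun i => Fin.cases (motive := fun i : Fin (L + 1) =>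
      (Fin n → (j : {j : Fin L // (j : ℕ) = i}) → S j.1) → Fin (Nm i) → (Fin n → U i))
      (fun _ _ _ => Classical.arbitrary _) (fun l => (f l).2) i
  obtain ⟨c, hcM, hc⟩ := exists_code (S := S) (Zh := Zh) (n := n) (fun i => Fin (Nm i))
    (by simp [Nm])
    (fun l x m => (f l).1 (x, decoder l.castSucc (fun i => ownSource l (x i)) m))
    (fun m i => g (decoder (Fin.last L)
      (fun _ j => absurd j.2 (by simpa using j.1.isLt.ne)) m i))
  refine ⟨c, fun l => by rw [hcM]; simp [Nm], ?_⟩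
  have hrec : ∀ s, c.reconstruction s = fun i => g (u s (Fin.last L) i) := by
    intro s
    let m : ∀ i, Fin (Nm i) := fun i => Fin.cases (motive := fun i => Fin (Nm i))
      (⟨0, Nat.one_pos⟩ : Fin 1) (fun l => (f l).1 (fun t => s t l, u s l.castSucc)) i
    have hdec : ∀ i : Fin (L + 1), decoder i (fun t j => s t j.1) (m i) = u s i := by
      intro i
      induction i using Fin.cases with
      | zero =>
        have : Subsingleton (U 0) := Fintype.card_le_one_iff_subsingleton.1 hU.le
        exact Subsingleton.elim (α := Fin n → U 0) _ _
      | succ l => exact hu s l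
    rw [hc s m]
    · funext i
      rw [← hdec]
      congr 2
      funext t j
      exact absurd j.2 (by simpa using j.1.isLt.ne)
    · intro l
      have : (fun t => ownSource l (s t l)) =
          fun t (j : {j : Fin L // (j : ℕ) = (l.castSucc : ℕ)}) => s t j.1 :=
        funext fun t => ownSource_apply l (s t)
      simp only [this, hdec]
      rfl
  refine le_trans (le_of_eq ?_) (hle.trans (le_of_eq ?_))
  · simp only [Code.distortion, hrec]
  · rw [← (blockEquiv S U n).symm.sum_comp, Fintype.sum_prod_type]
    refine sum_congr rfl fun s _ => ?_
    rw [mul_sum]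
    refine sum_congr rfl fun v _ => ?_
    rw [← mul_assoc, Finset.prod_comm, ← prod_mul_distrib]
    rfl

end Block

/-- The expectation of a sample mean under a product pmf. -/
theorem sum_block_mean {Ω : Type*} [Fintype Ω] (q F : Ω → ℝ) (hq : ∑ ω, q ω = 1) (n : ℕ)
    (hn : 1 ≤ n) :
    ∑ ω : Fin n → Ω, (∏ i, q (ω i)) * ((1 / (n : ℝ)) * ∑ i, F (ω i)) = ∑ ω, q ω * F ω := by
  classical
  have h : ∀ i : Fin n, ∑ ω : Fin n → Ω, (∏ j, q (ω j)) * F (ω i) = ∑ ω, q ω * F ω := by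
    intro i
    have h1 := Fintype.prod_sum fun (j : Fin n) a => q a * if j = i then F a else 1
    rw [Fintype.prod_eq_single i fun j hj => by simp [hj, hq]] at h1
    simp only [if_true] at h1
    rw [h1]
    refine sum_congr rfl fun ω _ => ?_
    rw [prod_mul_distrib, prod_ite_eq' univ i fun j => F (ω j)]
    simp
  have h2 : ∀ ω : Fin n → Ω, (∏ i, q (ω i)) * ((1 / (n : ℝ)) * ∑ i, F (ω i)) =
      (1 / (n : ℝ)) * ∑ i, (∏ j, q (ω j)) * F (ω i) := fun ω => by
    rw [← mul_sum]; ring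
  simp only [h2]
  rw [← mul_sum, sum_comm]
  simp only [h, sum_const, card_univ, Fintype.card_fin, nsmul_eq_mul]
  have : (n : ℝ) ≠ 0 := by exact_mod_cast (by omega : n ≠ 0)
  field_simp

/-! ### Exponential decay of the coding error -/

/-- If `log a` has a negative mean, then some moment of `a` is less than `1`: the moment of order
`ρ` has at `ρ = 0` the value `1` and the derivative `∑ q * log a`. -/
theorem exists_rpow_mean_lt_one {Ω : Type*} [Fintype Ω] {q a : Ω → ℝ} (hq : ∀ ω, 0 ≤ q ω)
    (hq1 : ∑ ω, q ω = 1) (ha : ∀ ω, 0 < q ω → 0 < a ω) (h : ∑ ω, q ω * Real.log (a ω) < 0) :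
    ∃ ρ : ℝ, 0 < ρ ∧ ρ ≤ 1 ∧ ∑ ω, q ω * a ω ^ ρ < 1 := by
  let f : ℝ → ℝ := fun ρ => ∑ ω, q ω * Real.exp (ρ * Real.log (a ω))
  have hf : HasDerivAt f (∑ ω, q ω * Real.log (a ω)) 0 := by
    refine HasDerivAt.fun_sum fun ω _ => ?_
    have h1 : HasDerivAt (fun ρ : ℝ => ρ * Real.log (a ω)) (Real.log (a ω)) 0 := by
      simpa using (hasDerivAt_id (0 : ℝ)).mul_const (Real.log (a ω))
    simpa using h1.exp.const_mul (q ω)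
  have hf0 : f 0 = 1 := by simp [f, hq1]
  have hlt := hf.tendsto_slope_zero_right.eventually_lt_const h
  have hle : ∀ᶠ t : ℝ in 𝓝[>] 0, t ≤ 1 :=
    (eventually_le_nhds zero_lt_one).filter_mono nhdsWithin_le_nhds
  obtain ⟨ρ, h1, h2, h3⟩ := (hlt.and (hle.and self_mem_nhdsWithin)).exists
  have h3 : 0 < ρ := h3
  refine ⟨ρ, h3, h2, ?_⟩
  have hfρ : f ρ = ∑ ω, q ω * a ω ^ ρ := by
    refine sum_congr rfl fun ω _ => ?_
    rcases (hq ω).eq_or_lt with h | h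
    · simp [← h]
    · rw [Real.rpow_def_of_pos (ha ω h), mul_comm ρ]
  rw [← hfρ, ← hf0, ← sub_neg]
  rw [zero_add, smul_eq_mul] at h1
  exact neg_of_mul_neg_right h1 (inv_pos.2 h3).le

theorem div_add_le_rpow {A B M ρ : ℝ} (hA : 0 < A) (hB : 0 < B) (hM : 0 < M) (hρ0 : 0 ≤ ρ)
    (hρ1 : ρ ≤ 1) : A / (M * B + A) ≤ (A / (M * B)) ^ ρ := by
  have hz : 0 < A / (M * B) := by positivity
  rcases le_total 1 (A / (M * B)) with h | h
  · exact (div_le_one_of_le₀ (by nlinarith [mul_pos hM hB]) (by positivity)).trans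
      (Real.one_le_rpow h hρ0)
  · calc A / (M * B + A) ≤ A / (M * B) :=
          div_le_div_of_nonneg_left hA.le (by positivity) (by linarith)
      _ = (A / (M * B)) ^ (1 : ℝ) := (Real.rpow_one _).symm
      _ ≤ _ := Real.rpow_le_rpow_of_exponent_ge hz h hρ1

theorem sum_block_error_le {Ω : Type*} [Fintype Ω] {q w v : Ω → ℝ} (hq : ∀ ω, 0 ≤ q ω)
    (hw : ∀ ω, 0 ≤ w ω) (hv : ∀ ω, 0 ≤ v ω)
    (hpos : ∀ ω, 0 < q ω → 0 < w ω ∧ 0 < v ω) {r ρ M : ℝ} (hρ0 : 0 ≤ ρ) (hρ1 : ρ ≤ 1) (n : ℕ)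
    (hM : (2 : ℝ) ^ (n * r) ≤ M) :
    ∑ ω : Fin n → Ω, (∏ i, q (ω i)) * ((∏ i, w (ω i)) / (M * (∏ i, v (ω i)) + ∏ i, w (ω i))) ≤
      (∑ ω, q ω * (w ω / v ω * 2 ^ (-r)) ^ ρ) ^ n := by
  rw [Fintype.sum_pow]
  refine sum_le_sum fun ω _ => ?_
  have hnn : ∀ ω, 0 ≤ w ω / v ω * 2 ^ (-r) := fun ω =>
    mul_nonneg (div_nonneg (hw ω) (hv ω)) (by positivity)
  by_cases h : ∀ i, 0 < q (ω i)
  · rw [prod_mul_distrib]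
    refine mul_le_mul_of_nonneg_left ?_ (prod_nonneg fun i _ => hq _)
    have hA : 0 < ∏ i, w (ω i) := prod_pos fun i _ => (hpos _ (h i)).1
    have hB : 0 < ∏ i, v (ω i) := prod_pos fun i _ => (hpos _ (h i)).2
    have h2 : (0 : ℝ) < 2 ^ (n * r) := by positivity
    calc _ ≤ (∏ i, w (ω i)) / (2 ^ (n * r) * (∏ i, v (ω i)) + ∏ i, w (ω i)) := by
          refine div_le_div_of_nonneg_left hA.le (by positivity) ?_
          gcongr
      _ ≤ ((∏ i, w (ω i)) / (2 ^ (n * r) * ∏ i, v (ω i))) ^ ρ :=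
          div_add_le_rpow hA hB h2 hρ0 hρ1
      _ = _ := by
          rw [Real.finsetProd_rpow _ _ fun i _ => hnn _]
          congr 1
          rw [prod_mul_distrib, prod_div_distrib, prod_const, card_univ, Fintype.card_fin,
            ← Real.rpow_mul_natCast (by norm_num), neg_mul, Real.rpow_neg (by norm_num),
            mul_comm r]
          field_simp
  · push Not at h
    obtain ⟨i, hi⟩ := h
    have hi' : q (ω i) = 0 := le_antisymm hi (hq _)
    rw [prod_eq_zero (mem_univ i) hi', zero_mul]
    exact prod_nonneg fun i _ => mul_nonneg (hq _) (Real.rpow_nonneg (hnn _) _)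

/-! ### Conditional mutual information along the cascade -/

/-- The conditional pmf of `Y` given `T = t`; zero if `T = t` has probability zero. -/
def condLaw {Ω β γ : Type*} [Fintype Ω] (q : Ω → ℝ) (Y : Ω → β) (T : Ω → γ) (t : γ) (y : β) : ℝ :=
  law q (fun ω => (Y ω, T ω)) (y, t) / law q T t

theorem condLaw_nonneg {Ω β γ : Type*} [Fintype Ω] {q : Ω → ℝ} (hq : ∀ ω, 0 ≤ q ω) (Y : Ω → β)
    (T : Ω → γ) (t : γ) (y : β) : 0 ≤ condLaw q Y T t y :=
  div_nonneg (law_nonneg hq _ _) (law_nonneg hq _ _)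

theorem sum_condLaw_le_one {Ω β γ : Type*} [Fintype Ω] [Fintype β] (q : Ω → ℝ)
    (Y : Ω → β) (T : Ω → γ) (t : γ) : ∑ y, condLaw q Y T t y ≤ 1 := by
  simp only [condLaw]
  rw [← sum_div, sum_law_prod_left]
  exact div_self_le_one _

theorem condLaw_pos {Ω β γ : Type*} [Fintype Ω] {q : Ω → ℝ} (hq : ∀ ω, 0 ≤ q ω) (Y : Ω → β)
    (T : Ω → γ) {ω : Ω} (hω : 0 < q ω) : 0 < condLaw q Y T (T ω) (Y ω) :=
  div_pos (hω.trans_le (le_law hq (fun ω => (Y ω, T ω)) ω)) (hω.trans_le (le_law hq T ω))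

section Kernel

variable {Ω α β γ : Type*} [Fintype Ω] [Fintype α] [Fintype β] [Fintype γ] {q : Ω → ℝ}
  {X : Ω → α} {Y : Ω → β} {T : Ω → γ} {W : α → β → ℝ}

/-- If `Y` is drawn from `X` with the kernel `W`, independently of `T`, then `I(X;Y|T)` is the mean
of `log (W(Y|X) / p(Y|T))`. -/
theorem condMutualInfo_eq_of_kernel (hq : ∀ ω, 0 ≤ q ω)
    (hW : ∀ x y t, law q (fun ω => (X ω, Y ω, T ω)) (x, y, t) =
      law q (fun ω => (X ω, T ω)) (x, t) * W x y) :
    condMutualInfo q X Y T =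
      ∑ ω, q ω * Real.logb 2 (W (X ω) (Y ω) / condLaw q Y T (T ω) (Y ω)) := by
  have h := sum_law_mul q (fun ω => (X ω, Y ω, T ω)) fun z => Real.logb 2 (law q T z.2.2 *
    law q (fun ω => (X ω, Y ω, T ω)) z / (law q (fun ω => (X ω, T ω)) (z.1, z.2.2) *
      law q (fun ω => (Y ω, T ω)) (z.2.1, z.2.2)))
  simp only [Fintype.sum_prod_type] at h
  rw [condMutualInfo, h]
  refine sum_congr rfl fun ω _ => ?_
  rcases (hq ω).eq_or_lt with h0 | h0
  · simp [← h0]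
  · have h1 : 0 < law q (fun ω => (X ω, T ω)) (X ω, T ω) :=
      h0.trans_le (le_law hq (fun ω => (X ω, T ω)) ω)
    have h2 : 0 < law q T (T ω) := h0.trans_le (le_law hq T ω)
    congr 2
    rw [hW, condLaw]
    field_simp

theorem condMutualInfo_nonneg_of_kernel (hq : ∀ ω, 0 ≤ q ω) (hq1 : ∑ ω, q ω = 1)
    (hW : ∀ x y t, law q (fun ω => (X ω, Y ω, T ω)) (x, y, t) =
      law q (fun ω => (X ω, T ω)) (x, t) * W x y)
    (hpos : ∀ ω, 0 < q ω → 0 < W (X ω) (Y ω)) :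
    0 ≤ condMutualInfo q X Y T := by
  rw [condMutualInfo_eq_of_kernel hq hW]
  -- `∑ q * (p(y|t) / W(y|x)) ≤ 1`, and `1 - 1 / z ≤ log z`
  have h1 : ∑ ω, q ω * (condLaw q Y T (T ω) (Y ω) / W (X ω) (Y ω)) ≤ 1 := by
    have h := sum_law_mul q (fun ω => (X ω, Y ω, T ω))
      fun z => condLaw q Y T z.2.2 z.2.1 / W z.1 z.2.1
    rw [← h]
    simp only [Fintype.sum_prod_type, hW]
    calc _ ≤ ∑ x, ∑ y, ∑ t, law q (fun ω => (X ω, T ω)) (x, t) * condLaw q Y T t y := by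
          refine sum_le_sum fun x _ => sum_le_sum fun y _ => sum_le_sum fun t _ => ?_
          rw [mul_assoc]
          refine mul_le_mul_of_nonneg_left ?_ (law_nonneg hq _ _)
          by_cases h0 : W x y = 0
          · simp [h0, condLaw_nonneg hq]
          · rw [mul_div_cancel₀ _ h0]
      _ = ∑ x, ∑ t, law q (fun ω => (X ω, T ω)) (x, t) * ∑ y, condLaw q Y T t y := by
          refine sum_congr rfl fun x _ => ?_
          rw [sum_comm]
          simp only [mul_sum]
      _ ≤ ∑ x, ∑ t, law q (fun ω => (X ω, T ω)) (x, t) :=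
          sum_le_sum fun x _ => sum_le_sum fun t _ =>
            mul_le_of_le_one_right (law_nonneg hq _ _) (sum_condLaw_le_one q Y T t)
      _ = 1 := by rw [← Fintype.sum_prod_type', ← hq1, ← sum_law q fun ω => (X ω, T ω)]
  have h2 : ∑ ω, q ω * (1 - condLaw q Y T (T ω) (Y ω) / W (X ω) (Y ω)) ≤
      ∑ ω, q ω * Real.log (W (X ω) (Y ω) / condLaw q Y T (T ω) (Y ω)) := by
    refine sum_le_sum fun ω _ => ?_
    rcases (hq ω).eq_or_lt with h0 | h0
    · simp [← h0]
    · refine mul_le_mul_of_nonneg_left ?_ (hq ω)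
      rw [← inv_div]
      exact Real.one_sub_inv_le_log_of_pos (div_pos (hpos ω h0) (condLaw_pos hq Y T h0))
  simp only [mul_sub, mul_one, sum_sub_distrib, hq1] at h2
  simp only [Real.logb, ← mul_div_assoc, ← sum_div]
  exact div_nonneg (by linarith) (Real.log_nonneg (by norm_num))

end Kernel

/-! ### Lossless codes and time sharing -/

section TimeSharing

variable {L : ℕ} {S : Fin L → Type*} [∀ l, Fintype (S l)] {Z Zh : Type*}

/-- The code that forwards all sources: the message at position `l` is the block of the first `l`
sources, and the decoder applies `zh` to each source vector. -/
theorem exists_lossless_code (p : (∀ l, S l) → ℝ) (hp1 : ∑ s, p s = 1) (φ : (∀ l, S l) → Z)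
    (d : Z → Zh → ℝ) (zh : (∀ l, S l) → Zh) (n : ℕ) (hn : 1 ≤ n) :
    ∃ c : Code S Zh n,
      (∀ l, c.M l = Fintype.card ((j : {j : Fin L // (j : ℕ) < l}) → S j.1) ^ n) ∧
      c.distortion p φ d = ∑ s, p s * d (φ s) (zh s) := by
  classical
  obtain ⟨c, hcM, hc⟩ := exists_code (S := S) (Zh := Zh) (n := n)
    (fun l => Fin n → (j : {j : Fin L // (j : ℕ) < l}) → S j.1)
    (Fintype.card_eq_one_iff.2 ⟨fun _ j => absurd j.2 (Nat.not_lt_zero _),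
      fun _ => funext fun _ => funext fun j => absurd j.2 (Nat.not_lt_zero _)⟩)
    (fun l x m i j => if h : (j : ℕ) < l then m i ⟨j.1, h⟩ else
      cast (congrArg S (Fin.ext (le_antisymm (not_lt.1 h) (Nat.lt_succ_iff.1 j.2)) : l = j.1)) (x i))
    (fun m i => zh fun j => m i ⟨j, by simp⟩)
  refine ⟨c, fun l => by rw [hcM]; simp, ?_⟩
  have hrec : ∀ s, c.reconstruction s = fun i => zh (s i) := by
    intro s
    refine hc s (fun l i j => s i j.1) fun l => ?_
    funext i ⟨j, hj⟩
    by_cases h : (j : ℕ) < l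
    · simp [h]
    · obtain rfl : l = j := Fin.ext (le_antisymm (not_lt.1 h) (Nat.lt_succ_iff.1 hj))
      simp
  simp only [Code.distortion, hrec]
  exact sum_block_mean p (fun s => d (φ s) (zh s)) hp1 n hn

theorem natCast_mul_distortion {n : ℕ} (c : Code S Zh n) (p : (∀ l, S l) → ℝ)
    (φ : (∀ l, S l) → Z) (d : Z → Zh → ℝ) :
    n * c.distortion p φ d = ∑ s : Fin n → ∀ l, S l, (∏ i, p (s i)) *
      ∑ i, d (φ (s i)) (c.reconstruction s i) := by
  rw [Code.distortion, mul_sum]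
  refine sum_congr rfl fun s _ => ?_
  rcases Nat.eq_zero_or_pos n with rfl | hn
  · simp
  · field_simp

/-- Using one code on the first part of the block and another one on the rest. -/
theorem exists_append_code (p : (∀ l, S l) → ℝ) (hp1 : ∑ s, p s = 1) (φ : (∀ l, S l) → Z)
    (d : Z → Zh → ℝ) {n₁ n₂ : ℕ} (c₁ : Code S Zh n₁) (c₂ : Code S Zh n₂) :
    ∃ c : Code S Zh (n₁ + n₂), (∀ l, c.M l = c₁.M l * c₂.M l) ∧
      ((n₁ + n₂ : ℕ) : ℝ) * c.distortion p φ d =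
        n₁ * c₁.distortion p φ d + n₂ * c₂.distortion p φ d := by
  classical
  obtain ⟨c, hcM, hc⟩ := exists_code (S := S) (Zh := Zh) (n := n₁ + n₂)
    (fun l => Fin (c₁.M l) × Fin (c₂.M l)) (by simp [c₁.M_zero, c₂.M_zero])
    (fun l x m => (c₁.enc l (fun i => x (Fin.castAdd n₂ i)) m.1,
      c₂.enc l (fun i => x (Fin.natAdd n₁ i)) m.2))
    (fun m => Fin.append (c₁.dec m.1) (c₂.dec m.2))
  refine ⟨c, fun l => by rw [hcM]; simp, ?_⟩
  have hrec : ∀ s, c.reconstruction s = Fin.append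
      (c₁.reconstruction fun i => s (Fin.castAdd n₂ i))
      (c₂.reconstruction fun i => s (Fin.natAdd n₁ i)) := fun s =>
    hc s (fun l => (c₁.msg (fun i => s (Fin.castAdd n₂ i)) l,
      c₂.msg (fun i => s (Fin.natAdd n₁ i)) l)) fun l => rfl
  have htot : ∀ n : ℕ, ∑ s : Fin n → ∀ l, S l, ∏ i, p (s i) = 1 := fun n =>
    sum_block_prod_eq_one (fun _ => p) fun _ => hp1
  simp only [natCast_mul_distortion, hrec]
  rw [← (Fin.appendEquiv n₁ n₂).sum_comp, Fintype.sum_prod_type]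
  simp only [Fin.appendEquiv, Equiv.coe_fn_mk, Fin.prod_univ_add, Fin.sum_univ_add,
    Fin.append_left, Fin.append_right, mul_add, sum_add_distrib]
  congr 1
  · refine sum_congr rfl fun s _ => ?_
    rw [← sum_mul, ← mul_sum, htot, mul_one]
  · rw [sum_comm]
    refine sum_congr rfl fun s _ => ?_
    rw [← sum_mul, ← sum_mul, htot, one_mul]

end TimeSharing

/-! ### Achievability -/

section Achievability

variable {L : ℕ} {S : Fin L → Type*} [∀ l, Fintype (S l)] {Z Zh : Type*}

theorem nonempty_of_mem_stdSimplex {ι : Type*} [Fintype ι] {p : ι → ℝ}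
    (hp : p ∈ stdSimplex ℝ ι) : Nonempty ι := by
  by_contra h
  rw [not_nonempty_iff] at h
  simpa using hp.2

/-- The sizes `⌈2 ^ (n * r)⌉` of the message sets have asymptotically the rate `r`. -/
theorem eventually_logb_ceil_le {r r' : ℝ} (hr : 0 ≤ r) (hrr' : r < r') :
    ∀ᶠ n : ℕ in atTop, Real.logb 2 ⌈(2 : ℝ) ^ (n * r)⌉₊ ≤ n * r' := by
  have h1 : Tendsto (fun n : ℕ => (n : ℝ) * (r' - r)) atTop atTop :=
    tendsto_natCast_atTop_atTop.atTop_mul_const (sub_pos.2 hrr')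
  filter_upwards [h1.eventually_ge_atTop 1] with n hn
  have h2 : (1 : ℝ) ≤ 2 ^ (n * r) := Real.one_le_rpow (by norm_num) (by positivity)
  have h3 : (⌈(2 : ℝ) ^ (n * r)⌉₊ : ℝ) ≤ 2 ^ (n * r + 1) := by
    have := (Nat.ceil_lt_add_one (zero_le_one.trans h2)).le
    rw [Real.rpow_add (by norm_num), Real.rpow_one]
    linarith
  have h4 : (0 : ℝ) < ⌈(2 : ℝ) ^ (n * r)⌉₊ := by
    exact_mod_cast Nat.ceil_pos.2 (zero_lt_one.trans_le h2)
  calc _ ≤ Real.logb 2 (2 ^ (n * r + 1)) := Real.logb_le_logb_of_le (by norm_num) h4 h3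
    _ = n * r + 1 := Real.logb_rpow (by norm_num) (by norm_num)
    _ ≤ n * r' := by linarith

/-- A tuple of the single-letter region is approached by codes of every large block length. -/
theorem eventually_exists_code {p : (∀ l, S l) → ℝ} (hp : p ∈ stdSimplex ℝ (∀ l, S l))
    {φ : (∀ l, S l) → Z} {d : Z → Zh → ℝ} (hd : ∀ z zh, 0 ≤ d z zh) {D : ℝ} {R : Fin L → ℝ}
    (hR : R ∈ ipRegion p φ d D) {ε : ℝ} (hε : 0 < ε) :
    ∀ᶠ n : ℕ in atTop, ∃ c : Code S Zh n,
      (∀ l : Fin L, Real.logb 2 (c.M l.succ) ≤ n * (R l + ε)) ∧ c.distortion p φ d ≤ D + ε := by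
  classical
  obtain ⟨k, hk, W, hW, g, hg, hI⟩ := hR
  have hp0 : ∀ s, 0 ≤ p s := hp.1
  have hW0 : ∀ l s u v, 0 ≤ W l s u v := fun l s u => (hW l s u).1
  have hW1 : ∀ l s u, ∑ v, W l s u v = 1 := fun l s u => (hW l s u).2
  obtain ⟨s₀⟩ : Nonempty (∀ l, S l) :=
    nonempty_of_mem_stdSimplex hp
  have hne : ∀ i, Nonempty (Fin (k i)) := by
    intro i
    induction i using Fin.induction with
    | zero => rw [hk]; infer_instance
    | succ l ih =>
      obtain ⟨u⟩ := ih
      exact nonempty_of_mem_stdSimplex (hW l (s₀ l) u)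
  let q := jointPmf (U := fun l => Fin (k l)) p W
  have hq : ∀ ω, 0 ≤ q ω := jointPmf_nonneg hp0 hW0
  have hq1 : ∑ ω, q ω = 1 := sum_jointPmf (by simp [hk]) hp.2 hW1
  let V := fun l : Fin L => condLaw q (fun ω => ω.2 l.succ) (fun ω => nextSource l ω.1)
  have hV : ∀ l t v, 0 ≤ V l t v := fun l => condLaw_nonneg hq _ _
  have hpos : ∀ l ω, 0 < q ω → 0 < W l (ω.1 l) (ω.2 l.castSucc) (ω.2 l.succ) ∧
      0 < V l (nextSource l ω.1) (ω.2 l.succ) := by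
    intro l ω h
    refine ⟨(hW0 _ _ _ _).lt_of_ne fun h0 => h.ne' ?_, condLaw_pos hq _ _ h⟩
    exact mul_eq_zero_of_right _ (prod_eq_zero (mem_univ l) h0.symm)
  have hker := fun l : Fin L => law_jointPmf (U := fun i => Fin (k i)) p hW1 l (nextSource l)
  have hI0 : ∀ l, 0 ≤ R l := fun l =>
    (condMutualInfo_nonneg_of_kernel (W := fun x v => W l x.1 x.2 v) hq hq1 (hker l)
      fun ω h => (hpos l ω h).1).trans (hI l)
  -- the rate `r l` exceeds the mutual information, so that a moment is less than one
  let r := fun l => R l + ε / 2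
  have hmom : ∀ l : Fin L, ∃ ρ : ℝ, 0 < ρ ∧ ρ ≤ 1 ∧
      ∑ ω, q ω * (W l (ω.1 l) (ω.2 l.castSucc) (ω.2 l.succ) /
        V l (nextSource l ω.1) (ω.2 l.succ) * 2 ^ (-r l)) ^ ρ < 1 := by
    intro l
    refine exists_rpow_mean_lt_one hq hq1 (fun ω h => ?_) ?_
    · exact mul_pos (div_pos (hpos l ω h).1 (hpos l ω h).2) (by positivity)
    · have hI' := hI l
      rw [condMutualInfo_eq_of_kernel (W := fun x v => W l x.1 x.2 v) hq (hker l)] at hI'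
      have hlog2 : 0 < Real.log 2 := Real.log_pos (by norm_num)
      calc _ = (∑ ω, q ω * Real.logb 2 (W l (ω.1 l) (ω.2 l.castSucc) (ω.2 l.succ) /
              V l (nextSource l ω.1) (ω.2 l.succ)) - r l) * Real.log 2 := by
            have hr : ∑ ω, q ω * r l = r l := by rw [← sum_mul, hq1, one_mul]
            nth_rewrite 2 [← hr]
            rw [← sum_sub_distrib, sum_mul]
            refine sum_congr rfl fun ω _ => ?_
            rcases (hq ω).eq_or_lt with h | h
            · simp [← h]
            · rw [Real.log_mul (div_pos (hpos l ω h).1 (hpos l ω h).2).ne' (by positivity),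
                Real.log_rpow (by norm_num), Real.logb]
              field_simp
              ring
        _ < 0 := by
            refine mul_neg_of_neg_of_pos ?_ hlog2
            simp only [r]
            exact sub_neg.2 (lt_of_le_of_lt hI' (by linarith))
  choose ρ hρ0 hρ1 hρ using hmom
  let B := ∑ s, ∑ u, d (φ s) (g u)
  have hB : ∀ s u, d (φ s) (g u) ≤ B := fun s u =>
    (single_le_sum (fun u _ => hd (φ s) (g u)) (mem_univ u)).trans
      (single_le_sum (f := fun s => ∑ u, d (φ s) (g u))
        (fun s _ => sum_nonneg fun u _ => hd _ _) (mem_univ s))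
  have hB0 : 0 ≤ B := sum_nonneg fun s _ => sum_nonneg fun u _ => hd _ _
  have hlim : Tendsto (fun n : ℕ => D + B * ∑ l : Fin L,
      (∑ ω, q ω * (W l (ω.1 l) (ω.2 l.castSucc) (ω.2 l.succ) /
        V l (nextSource l ω.1) (ω.2 l.succ) * 2 ^ (-r l)) ^ ρ l) ^ n) atTop (𝓝 D) := by
    have h := tendsto_finsetSum (univ : Finset (Fin L)) fun l _ =>
      tendsto_pow_atTop_nhds_zero_of_lt_one (sum_nonneg fun ω _ => mul_nonneg (hq ω)
        (Real.rpow_nonneg (mul_nonneg (div_nonneg (hW0 _ _ _ _) (hV _ _ _)) (by positivity)) _))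
        (hρ l)
    simpa using (h.const_mul B).const_add D
  have hrate : ∀ᶠ n : ℕ in atTop, ∀ l, Real.logb 2 ⌈(2 : ℝ) ^ (n * r l)⌉₊ ≤ n * (R l + ε) :=
    eventually_all.2 fun l => eventually_logb_ceil_le (by simp only [r]; linarith [hI0 l])
      (by simp only [r]; linarith)
  filter_upwards [hrate, hlim.eventually_le_const (by linarith : D < D + ε),
    eventually_ge_atTop 1] with n h1 h2 hn
  obtain ⟨c, hcM, hc⟩ := exists_code_distortion_le (U := fun i => Fin (k i)) (by simp [hk]) p hp0 W
    hW0 hW1 V hV (fun l t => sum_condLaw_le_one q _ _ t) φ d hd g B hB n hn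
    (fun l => ⌈(2 : ℝ) ^ (n * r l)⌉₊) fun l => Nat.ceil_pos.2 (by positivity)
  refine ⟨c, fun l => by rw [hcM]; exact h1 l, hc.trans (le_trans ?_ h2)⟩
  simp only [mul_add, sum_add_distrib]
  refine add_le_add ((sum_block_mean q (fun ω => d (φ ω.1) (g (ω.2 (Fin.last L)))) hq1 n
    hn).trans_le hg) ?_
  simp only [mul_left_comm _ B]
  rw [← mul_sum]
  refine mul_le_mul_of_nonneg_left ?_ hB0
  simp only [mul_sum]
  rw [sum_comm]
  refine sum_le_sum fun l _ => ?_
  exact sum_block_error_le hq (fun ω => hW0 _ _ _ _) (fun ω => hV _ _ _) (hpos l) (hρ0 l).le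
    (hρ1 l) n (Nat.le_ceil _)

theorem ipRegion_subset_rdRegion {p : (∀ l, S l) → ℝ} (hp : p ∈ stdSimplex ℝ (∀ l, S l))
    {φ : (∀ l, S l) → Z} {d : Z → Zh → ℝ} (hd : ∀ z zh, 0 ≤ d z zh) (D : ℝ) :
    ipRegion p φ d D ⊆ rdRegion p φ d D := by
  intro R hR
  refine Metric.mem_closure_iff.2 fun ε hε => ?_
  obtain ⟨n, ⟨c, hc, hcD⟩, hn⟩ :=
    ((eventually_exists_code hp hd hR (half_pos hε)).and (eventually_ge_atTop 1)).exists
  have hn' : (0 : ℝ) < n := by exact_mod_cast hn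
  refine ⟨(fun l => R l + ε / 2, D + ε / 2), ⟨n, hn, c, fun l => ?_, hcD⟩, ?_⟩
  · rw [div_le_iff₀' hn']
    exact hc l
  · refine lt_of_le_of_lt (max_le ((dist_pi_le_iff (half_pos hε).le).2 fun l => ?_) ?_)
      (half_lt_self hε)
    · simp [abs_of_pos hε]
    · simp [abs_of_pos hε]

/-- Above the least possible distortion the constraint is met exactly: on a small fraction of the
block the sources are forwarded, which makes up for the excess distortion on the rest. -/
theorem ipRegion_subset_exactRDRegion {p : (∀ l, S l) → ℝ} (hp : p ∈ stdSimplex ℝ (∀ l, S l))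
    {φ : (∀ l, S l) → Z} {d : Z → Zh → ℝ} (hd : ∀ z zh, 0 ≤ d z zh) {D : ℝ}
    (hD : minDistortion p φ d < D) : ipRegion p φ d D ⊆ exactRDRegion p φ d D := by
  classical
  intro R hR
  have hs : Nonempty (∀ l, S l) := nonempty_of_mem_stdSimplex hp
  have hZh : Nonempty Zh := by
    obtain ⟨n, ⟨c, -⟩, hn⟩ :=
      ((eventually_exists_code hp hd hR one_pos).and (eventually_ge_atTop 1)).exists
    exact ⟨c.reconstruction (fun _ => hs.some) ⟨0, hn⟩⟩
  -- a nearly optimal reproduction for each source vector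
  have hzh : ∀ s, ∃ z, d (φ s) z < (⨅ z, d (φ s) z) + (D - minDistortion p φ d) / 2 := fun s =>
    exists_lt_of_ciInf_lt (lt_add_of_pos_right _ (half_pos (sub_pos.2 hD)))
  choose zh hzh using hzh
  set D₂ := ∑ s, p s * d (φ s) (zh s) with hD₂
  have hD₂lt : D₂ < D := by
    have : D₂ ≤ minDistortion p φ d + (D - minDistortion p φ d) / 2 := by
      calc D₂ ≤ ∑ s, p s * ((⨅ z, d (φ s) z) + (D - minDistortion p φ d) / 2) :=
            sum_le_sum fun s _ => mul_le_mul_of_nonneg_left (hzh s).le (hp.1 s)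
        _ = _ := by
            simp only [mul_add, sum_add_distrib]
            rw [← sum_mul, hp.2, one_mul, minDistortion]
    linarith
  refine Metric.mem_closure_iff.2 fun ε hε => ?_
  let C : Fin L → ℝ := fun l =>
    Real.logb 2 (Fintype.card ((j : {j : Fin L // (j : ℕ) < l.succ}) → S j.1))
  -- the sources are forwarded on one part in `a + 1` of the block: `a` is large enough for this to
  -- be cheap in rate, and then `ε₁` small enough for the excess distortion to be made up for
  obtain ⟨a, ha1, haC⟩ : ∃ a : ℕ, 1 ≤ a ∧ ∀ l, C l - R l ≤ a * (ε / 4) := by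
    have h : ∀ l, ∀ᶠ a : ℕ in atTop, C l - R l ≤ a * (ε / 4) := fun l =>
      (tendsto_natCast_atTop_atTop.atTop_mul_const (by positivity)).eventually_ge_atTop _
    exact ((eventually_ge_atTop 1).and (eventually_all.2 h)).exists
  have ha : (0 : ℝ) < a := by exact_mod_cast ha1
  set ε₁ := min (ε / 4) ((D - D₂) / a) with hε₁
  have hε₁0 : 0 < ε₁ := lt_min (by positivity) (div_pos (sub_pos.2 hD₂lt) ha)
  obtain ⟨N₀, hN₀⟩ := eventually_atTop.1 (eventually_exists_code hp hd hR hε₁0)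
  let N := max N₀ 1
  have hN1 : 1 ≤ N := le_max_right _ _
  have hN : (0 : ℝ) < N := by exact_mod_cast hN1
  obtain ⟨c₁, hc₁, hc₁D⟩ := hN₀ (a * N)
    ((le_max_left _ _).trans (Nat.le_mul_of_pos_left _ ha1))
  obtain ⟨c₂, hc₂, hc₂D⟩ := exists_lossless_code p hp.2 φ d zh N hN1
  obtain ⟨c, hc, hcD⟩ := exists_append_code p hp.2 φ d c₁ c₂
  have hn : (0 : ℝ) < (a * N + N : ℕ) := by exact_mod_cast (by omega)
  refine ⟨fun l => R l + ε / 2, ⟨a * N + N, by omega, c, fun l => ?_, ?_⟩, ?_⟩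
  · have hlog : Real.logb 2 (c.M l.succ) ≤ Real.logb 2 (c₁.M l.succ) + N * C l := le_of_eq <| by
      rw [hc, hc₂, Nat.cast_mul, Nat.cast_pow]
      have h1 : (c₁.M l.succ : ℝ) ≠ 0 := by
        exact_mod_cast (Fin.pos (c₁.msg (fun _ => hs.some) l.succ)).ne'
      have h2 : (Fintype.card ((j : {j : Fin L // (j : ℕ) < l.succ}) → S j.1) : ℝ) ≠ 0 := by
        have : Nonempty ((j : {j : Fin L // (j : ℕ) < l.succ}) → S j.1) := ⟨fun j => hs.some j.1⟩
        exact_mod_cast Fintype.card_ne_zero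
      rw [Real.logb_mul h1 (pow_ne_zero _ h2), Real.logb_pow]
    rw [div_le_iff₀' hn]
    have h1 := hc₁ l
    have h2 : a * ε₁ ≤ a * (ε / 4) := mul_le_mul_of_nonneg_left (min_le_left _ _) ha.le
    have h3 := haC l
    push_cast at h1 ⊢
    have h4 : N * (a * ε₁ + C l) ≤ N * (R l + (a + 1) * (ε / 2)) :=
      mul_le_mul_of_nonneg_left (by linarith) hN.le
    linarith
  · rw [← mul_le_mul_iff_right₀ hn, hcD, hc₂D]
    have h2 : a * ε₁ ≤ D - D₂ := by
      rw [← le_div_iff₀' ha]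
      exact min_le_right _ _
    push_cast
    have h3 := mul_le_mul_of_nonneg_left hc₁D (by positivity : (0 : ℝ) ≤ a * N)
    have h4 := mul_le_mul_of_nonneg_left h2 hN.le
    linarith
  · refine lt_of_le_of_lt ((dist_pi_le_iff (half_pos hε).le).2 fun l => ?_) (half_lt_self hε)
    simp [abs_of_pos hε]

end Achievability

end Cascade

end

theorem theorem2 {L : ℕ} {S : Fin L → Type*} [∀ l, Fintype (S l)] {Z Zh : Type*}
    (p : (∀ l, S l) → ℝ) (hp : p ∈ stdSimplex ℝ (∀ l, S l))
    (φ : (∀ l, S l) → Z) (d : Z → Zh → ℝ) (hd : ∀ z zh, 0 ≤ d z zh) (D : ℝ) :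
    Cascade.ipRegion p φ d D ⊆ Cascade.rdRegion p φ d D ∧
    (Cascade.minDistortion p φ d < D →
      Cascade.ipRegion p φ d D ⊆ Cascade.exactRDRegion p φ d D) :=
  ⟨Cascade.ipRegion_subset_rdRegion hp hd D, fun h =>
    Cascade.ipRegion_subset_exactRDRegion hp hd h⟩
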